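/- Equip $\mathbb{R}^4$ with coordinates $\mathbf{s}=(s_1,s_2,s_3,s_4)$ and, for $i=1,\dots,4$, let $\sigma_i$ be the linear involution that replaces $s_i$ by $-s_i$ and $s_j$ by $s_j+2s_i$ for every $j\neq i$. (These are the simple reflections, written in fundamental-weight coordinates, of the root system with Cartan matrix having $2$ on the diagonal and $-2$ elsewhere.) Let $W=\langle\sigma_1,\sigma_2,\sigma_3,\sigma_4\rangle$ be the Apollonian group, let $$C=\{\mathbf{s}\in\mathbb{R}^4 \mid \text{all } s_i\ge 0,\ \text{at most one } s_i=0\},\qquad A=\bigcup_{w\in W}w(C),$$ and regard $A$ as a subset of $\mathbb{RP}^3$ (the set of lines through the origin that meet $A$), with closure $\bar A$ in $\mathbb{RP}^3$. Then every point of $\mathbb{RP}^3\setminus\bar A$ has a $W$-translate with three negative coordinates, or with two negative coordinates and one zero coordinate. Precisely: if $\mathbf{s}\in\mathbb{R}^4\setminus\{0\}$ is any vector representing a point of $\mathbb{RP}^3\setminus\bar A$ (in particular, if it is a representative normalized by $s_1+s_2+s_3+s_4\ge 0$), then there is $w\in W$ such that $w(\mathbf{s})$ has exactly three negative coordinates,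 or exactly two negative coordinates and exactly one zero coordinate. -/

import Mathlib

noncomputable section

namespace Apollonian

/-- The Cartan matrix of the Apollonian root system: `2` on the diagonal and `-2` elsewhere. -/
def cartan : Matrix (Fin 4) (Fin 4) ℝ := fun i j => if i = j then 2 else -2

/-- The real vector space `ℝ⁴` carrying the root system. A vector `s` is given by its coordinates
`s 0, …, s 3` with respect to the fundamental weights, the basis dual to the simple roots for the
bilinear form: `s i = (α i, s)`. -/
abbrev V : Type := Fin 4 → ℝ

/-- The simple root `α i` in fundamental weight coordinates: its `j`-th coordinate is
`(α j, α i) = cartan j i`. -/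
def simpleRoot (i : Fin 4) : V := fun j => cartan j i

theorem proj_simpleRoot (i : Fin 4) :
    (LinearMap.proj i : V →ₗ[ℝ] ℝ) (simpleRoot i) = 2 := by
  simp [simpleRoot, cartan]

/-- The simple reflection `σ i : s ↦ s - (α i, s) α i`. -/
def sigma (i : Fin 4) : V ≃ₗ[ℝ] V := Module.reflection (proj_simpleRoot i)

/-- The defining formula `σ i (α j) = α j - (α j, α i) α i` on simple roots. -/
theorem sigma_simpleRoot (i j : Fin 4) :
    sigma i (simpleRoot j) = simpleRoot j - cartan i j • simpleRoot i := by
  rw [sigma, Module.reflection_apply]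
  rfl

/-- In weight coordinates, `σ i` negates `s i` and adds `2 * s i` to each of the others. -/
theorem sigma_apply (i : Fin 4) (s : V) (j : Fin 4) :
    sigma i s j = if j = i then -s i else s j + 2 * s i := by
  rw [sigma, Module.reflection_apply]
  by_cases h : j = i
  · subst h
    simp [simpleRoot, cartan]
    ring
  · simp [simpleRoot, cartan, h]
    ring

/-- The Apollonian group: the Weyl group generated by the four simple reflections. -/
def W : Subgroup (V ≃ₗ[ℝ] V) := Subgroup.closure (Set.range sigma)

/-- The vectors with all coordinates nonnegative and at most one coordinate equal to zero. -/
def C : Set V :=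
  {s | (∀ i, 0 ≤ s i) ∧ (Finset.univ.filter fun i => s i = 0).card ≤ 1}

/-- The (real) Apollonian cone: the union of the `W`-translates of `C`. -/
def A : Set V := ⋃ w ∈ W, w '' C

/-- Real projective 3-space. -/
abbrev RP3 : Type := Projectivization ℝ V

/-- The usual topology of projective space: the quotient topology from `ℝ⁴ ∖ {0}`. -/
instance : TopologicalSpace RP3 :=
  TopologicalSpace.coinduced (Projectivization.mk' ℝ : {v : V // v ≠ 0} → RP3) inferInstance

/-- The Apollonian cone as a subset of projective space: the set of lines through points of `A`. -/
def projA : Set RP3 := {p | ∃ (s : V) (hs : s ≠ 0), s ∈ A ∧ Projectivization.mk ℝ s hs = p}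

/-- The number of negative coordinates. -/
def negCount (s : V) : ℕ := (Finset.univ.filter fun i => s i < 0).card

/-- The number of zero coordinates. -/
def zeroCount (s : V) : ℕ := (Finset.univ.filter fun i => s i = 0).card

end Apollonian

end

namespace Apollonian

/-! Everything depends on the sums of two coordinates over the orbit of `s`. If one is negative,
alternating the two reflections drives the other two coordinates quadratically to `-∞` while the
pair itself grows linearly with opposite signs, so three coordinates end up negative
(`exists_negCount_eq_three`); the first alternative is thus always attained. If none is negative,
`s` lies in the closure: the orbit of `(1, 1, 1, 1)` has pair sums at least `1`, so those of `s +
ε(1, 1, 1, 1)` are at least `ε`, and reflecting in negative coordinates then ends in `C`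
(`mem_A_of_pair_sums`). -/

theorem sigma_mem_W (i : Fin 4) : sigma i ∈ W := Subgroup.subset_closure ⟨i, rfl⟩

/-- Alternating the reflections `σ i` and `σ j` moves the `i`-th and `j`-th coordinates linearly and
the other two quadratically. -/
theorem exists_mem_W_dihedral {i j : Fin 4} (hij : i ≠ j) (s : V) (n : ℕ) :
    ∃ w ∈ W, w s i = s i + 2 * n * (s i + s j) ∧ w s j = s j - 2 * n * (s i + s j) ∧
      ∀ k, k ≠ i → k ≠ j →
        w s k = s k + 4 * (s i + s j) * n ^ 2 + (4 * s i - 2 * (s i + s j)) * n := by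
  induction n with
  | zero => exact ⟨1, W.one_mem, by simp, by simp, by simp⟩
  | succ n ih =>
    obtain ⟨w, hw, hi, hj, hk⟩ := ih
    refine ⟨sigma j * (sigma i * w),
      W.mul_mem (sigma_mem_W j) (W.mul_mem (sigma_mem_W i) hw), ?_, ?_, fun k hki hkj => ?_⟩
    · simp only [LinearEquiv.mul_apply, sigma_apply, hij, hij.symm, if_true, if_false, hi, hj]
      push_cast; ring
    · simp only [LinearEquiv.mul_apply, sigma_apply, hij.symm, if_true, if_false, hi, hj]
      push_cast; ring
    · simp only [LinearEquiv.mul_apply, sigma_apply, hij.symm, hki, hkj, if_false, hi, hj,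
        hk k hki hkj]
      push_cast; ring

/-- A vector with a negative sum of two coordinates has a translate with exactly three negative
coordinates. -/
theorem exists_negCount_eq_three {i j : Fin 4} (hij : i ≠ j) {s : V} (h : s i + s j < 0) :
    ∃ w ∈ W, negCount (w s) = 3 := by
  set d := -(s i + s j) with hd
  have hd0 : 0 < d := by linarith
  set M := ∑ k, |s k| with hM
  have hle : ∀ k, |s k| ≤ M := fun k =>
    Finset.single_le_sum (f := fun k => |s k|) (fun _ _ => abs_nonneg _) (Finset.mem_univ k)
  have hM0 : 0 ≤ M := (abs_nonneg _).trans (hle 0)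
  -- The other two coordinates are at most `M + 4 * M * n - 4 * d * n ^ 2`, which is at most `5 * M
  -- * n - 4 * d * n ^ 2` once `1 ≤ n`; the factor `10` is a generous margin.
  obtain ⟨n, hn⟩ := exists_nat_gt ((10 * M) / d)
  have hnd : 10 * M < n * d := (div_lt_iff₀ hd0).1 hn
  have hn1 : (1 : ℝ) ≤ n := by
    have : 0 < n := by
      rcases Nat.eq_zero_or_pos n with h0 | h0
      · subst h0; simp at hnd; linarith
      · exact h0
    exact_mod_cast this
  obtain ⟨w, hw, hi, hj, hk⟩ := exists_mem_W_dihedral hij s n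
  have hsum : s i + s j = -d := by linarith
  rw [hsum] at hi hj
  have hi0 : w s i < 0 := by
    have := (abs_le.1 (hle i)).2
    nlinarith
  have hj0 : 0 < w s j := by
    have := (abs_le.1 (hle j)).1
    nlinarith
  have hk0 : ∀ k, k ≠ i → k ≠ j → w s k < 0 := fun k hki hkj => by
    rw [hk k hki hkj, hsum]
    have h1 := (abs_le.1 (hle k)).2
    have h2 := (abs_le.1 (hle i)).2
    have h3 := (abs_le.1 (hle j)).2
    have h4 := (abs_le.1 (hle j)).1
    have h5 : 2 * s i - 2 * s j ≤ 4 * M := by linarith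
    have h6 : 4 * s i - 2 * -d = 2 * s i - 2 * s j := by linarith
    rw [h6]
    have h7 : (2 * s i - 2 * s j) * n ≤ 4 * M * n := mul_le_mul_of_nonneg_right h5 (by linarith)
    have h8 : 10 * M * n < n * d * n := mul_lt_mul_of_pos_right hnd (by linarith)
    have h9 : M ≤ M * n := le_mul_of_one_le_right hM0 hn1
    nlinarith
  refine ⟨w, hw, ?_⟩
  have : (Finset.univ.filter fun k => w s k < 0) = Finset.univ.erase j := by
    ext k
    simp only [Finset.mem_filter, Finset.mem_univ, true_and, Finset.mem_erase, and_true]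
    constructor
    · rintro hlt rfl
      exact lt_asymm hlt hj0
    · intro hkj
      by_cases hki : k = i
      · exact hki ▸ hi0
      · exact hk0 k hki hkj
  rw [negCount, this, Finset.card_erase_of_mem (Finset.mem_univ j)]
  simp

theorem mem_A_of_mem_C {s : V} (hs : s ∈ C) : s ∈ A :=
  Set.mem_biUnion W.one_mem ⟨s, hs, rfl⟩

theorem mem_A_of_sigma_mem_A {s : V} (i : Fin 4) (h : sigma i s ∈ A) : s ∈ A := by
  simp only [A, Set.mem_iUnion] at h ⊢
  obtain ⟨w, hw, x, hx, hxs⟩ := h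
  refine ⟨(sigma i)⁻¹ * w, W.mul_mem (W.inv_mem (sigma_mem_W i)) hw, x, hx, ?_⟩
  rw [LinearEquiv.mul_apply, hxs, ← LinearEquiv.mul_apply, inv_mul_cancel]
  rfl

theorem sum_sigma (i : Fin 4) (s : V) : ∑ k, sigma i s k = ∑ k, s k + 4 * s i := by
  simp only [sigma_apply, Fin.sum_univ_four]
  fin_cases i <;> simp <;> ring

theorem mem_C_of_nonneg {s : V} (h0 : ∀ i, 0 ≤ s i) (h : ∀ i j, i ≠ j → 0 < s i + s j) :
    s ∈ C := by
  refine ⟨h0, Finset.card_le_one.2 fun a ha b hb => ?_⟩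
  by_contra hab
  have := h a b hab
  simp only [Finset.mem_filter, Finset.mem_univ, true_and] at ha hb
  linarith

/-- If the sums of two coordinates are uniformly positive over the orbit of `s`, then reflecting in
negative coordinates terminates, in `C`. -/
theorem mem_A_of_pair_sums {c : ℝ} (hc : 0 < c) (n : ℕ) (s : V)
    (h : ∀ w ∈ W, ∀ i j, i ≠ j → c ≤ w s i + w s j) (hn : ∑ k, s k < n * c) : s ∈ A := by
  induction n generalizing s with
  | zero =>
    -- Two disjoint pairs make the total at least `2 * c`, so it cannot be negative.
    have h1 := h 1 W.one_mem 0 1 (by decide)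
    have h2 := h 1 W.one_mem 2 3 (by decide)
    simp only [LinearEquiv.coe_one, id_eq] at h1 h2
    simp only [Fin.sum_univ_four, Nat.cast_zero, zero_mul] at hn
    linarith
  | succ n ih =>
    by_cases hs : ∀ i, 0 ≤ s i
    · exact mem_A_of_mem_C
        (mem_C_of_nonneg hs fun i j hij => hc.trans_le (h 1 W.one_mem i j hij))
    push Not at hs
    obtain ⟨i, hi⟩ := hs
    refine mem_A_of_sigma_mem_A i ?_
    have h' : ∀ w ∈ W, ∀ a b, a ≠ b → c ≤ w (sigma i s) a + w (sigma i s) b :=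
      fun w hw => h (w * sigma i) (W.mul_mem hw (sigma_mem_W i))
    by_cases hs' : ∀ j, 0 ≤ sigma i s j
    · exact mem_A_of_mem_C
        (mem_C_of_nonneg hs' fun a b hab => hc.trans_le (h' 1 W.one_mem a b hab))
    push Not at hs'
    obtain ⟨j, hj⟩ := hs'
    have hii : sigma i s i = -s i := by simp [sigma_apply]
    have hij : i ≠ j := by
      rintro rfl
      linarith
    have hsum : c ≤ sigma i s i + sigma i s j := h' 1 W.one_mem i j hij
    -- Since coordinate `j` is still negative, `hsum` forces `-s i > c`: the reflection lowered the
    -- total by more than `4 * c`, and a drop of `c` suffices.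
    refine ih _ h' ?_
    rw [sum_sigma]
    push_cast at hn
    linarith

/-- The orbit of `(1, 1, 1, 1)` consists of integral vectors in the open positive light cone. -/
theorem exists_int_of_mem_W {w : V ≃ₗ[ℝ] V} (hw : w ∈ W) :
    ∃ z : Fin 4 → ℤ, (w (fun _ => 1) = fun k => (z k : ℝ)) ∧
      2 * ∑ k, z k ^ 2 < (∑ k, z k) ^ 2 ∧ 0 < ∑ k, z k := by
  have step : ∀ i : Fin 4, ∀ v : V,
      (∃ z : Fin 4 → ℤ, (v = fun k => (z k : ℝ)) ∧
        2 * ∑ k, z k ^ 2 < (∑ k, z k) ^ 2 ∧ 0 < ∑ k, z k) →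
      ∃ z : Fin 4 → ℤ, (sigma i v = fun k => (z k : ℝ)) ∧
        2 * ∑ k, z k ^ 2 < (∑ k, z k) ^ 2 ∧ 0 < ∑ k, z k := by
    rintro i v ⟨z, rfl, hq, hp⟩
    refine ⟨fun k => if k = i then -z i else z k + 2 * z i, ?_, ?_, ?_⟩
    · ext k
      rw [sigma_apply]
      split_ifs <;> simp [*]
    -- The form `(∑ z k) ^ 2 - 2 * ∑ z k ^ 2` is invariant under each reflection.
    · simp only [Fin.sum_univ_four] at hq ⊢
      fin_cases i <;> simp <;> linarith
    · have hsum : ∑ k, (if k = i then -z i else z k + 2 * z i) = ∑ k, z k + 4 * z i := by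
        simp only [Fin.sum_univ_four]
        fin_cases i <;> simp <;> ring
      rw [hsum]
      by_contra hneg
      -- the other three coordinates have sum `S - z i`, so `3 * ∑_{k ≠ i} z k ^ 2 ≥ (S - z i) ^ 2`
      simp only [Fin.sum_univ_four] at hq hp hneg
      fin_cases i <;> simp at hneg
      · nlinarith [sq_nonneg (z 1 - z 2), sq_nonneg (z 1 - z 3), sq_nonneg (z 2 - z 3)]
      · nlinarith [sq_nonneg (z 0 - z 2), sq_nonneg (z 0 - z 3), sq_nonneg (z 2 - z 3)]
      · nlinarith [sq_nonneg (z 1 - z 0), sq_nonneg (z 1 - z 3), sq_nonneg (z 0 - z 3)]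
      · nlinarith [sq_nonneg (z 1 - z 2), sq_nonneg (z 1 - z 0), sq_nonneg (z 2 - z 0)]
  induction hw using Subgroup.closure_induction_left with
  | one => exact ⟨fun _ => 1, by ext; simp, by simp, by simp⟩
  | mul_left x hx y _ ih =>
    obtain ⟨i, rfl⟩ := hx
    exact step i _ ih
  | inv_mul_cancel x hx y _ ih =>
    obtain ⟨i, rfl⟩ := hx
    have : (sigma i)⁻¹ = sigma i := by
      rw [inv_eq_iff_mul_eq_one]
      ext v : 1
      exact Module.involutive_reflection (proj_simpleRoot i) v
    rw [this]
    exact step i _ ih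

/-- By `2(a² + b²) ≥ (a + b)²`, and likewise for `c, d`, the light cone inequality gives `(a + b)(c
+ d) > 0`. As the total is positive, so is `a + b`, and integrality raises this to `1`. -/
theorem one_le_pair_sum {w : V ≃ₗ[ℝ] V} (hw : w ∈ W) {i j : Fin 4} (hij : i ≠ j) :
    1 ≤ w (fun _ => 1) i + w (fun _ => 1) j := by
  obtain ⟨z, hz, hq, hp⟩ := exists_int_of_mem_W hw
  simp only [hz]
  have pos : ∀ a b c d : ℤ, 2 * (a ^ 2 + b ^ 2 + c ^ 2 + d ^ 2) < (a + b + c + d) ^ 2 →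
      0 < a + b + c + d → 1 ≤ a + b := by
    intro a b c d h1 h2
    by_contra hneg
    have h3 : a + b ≤ 0 := by omega
    have h4 : 0 < c + d := by omega
    nlinarith [sq_nonneg (a - b), sq_nonneg (c - d), mul_nonneg (neg_nonneg.2 h3) h4.le]
  have : 1 ≤ z i + z j := by
    simp only [Fin.sum_univ_four] at hq hp
    obtain ⟨k, l, hq', hp'⟩ : ∃ k l : Fin 4,
        2 * (z i ^ 2 + z j ^ 2 + z k ^ 2 + z l ^ 2) < (z i + z j + z k + z l) ^ 2 ∧
        0 < z i + z j + z k + z l := by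
      obtain ⟨k, l, hkl⟩ : ∃ k l : Fin 4, ({i, j, k, l} : Finset (Fin 4)) = Finset.univ := by
        revert i j; decide
      have hnd : i ∉ ({j, k, l} : Finset (Fin 4)) ∧ j ∉ ({k, l} : Finset (Fin 4)) ∧
          k ∉ ({l} : Finset (Fin 4)) := by
        revert i j k l; decide
      have hsum : ∀ f : Fin 4 → ℤ, f 0 + f 1 + f 2 + f 3 = f i + f j + f k + f l := fun f => by
        rw [← Fin.sum_univ_four, ← hkl, Finset.sum_insert hnd.1, Finset.sum_insert hnd.2.1,
          Finset.sum_insert hnd.2.2, Finset.sum_singleton]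
        ring
      refine ⟨k, l, ?_, ?_⟩
      · rw [← hsum z, ← hsum fun k => z k ^ 2]
        exact hq
      · rw [← hsum z]
        exact hp
    exact pos _ _ _ _ hq' hp'
  exact_mod_cast this

/-- If all sums of two coordinates over the orbit of `s` are nonnegative, then shifting `s` in the
direction `(1, 1, 1, 1)` moves it into the Apollonian cone. -/
theorem add_smul_one_mem_A {s : V} (h : ∀ w ∈ W, ∀ i j, i ≠ j → 0 ≤ w s i + w s j)
    {ε : ℝ} (hε : 0 < ε) : s + ε • (fun _ => 1 : V) ∈ A := by
  obtain ⟨n, hn⟩ := exists_nat_gt ((∑ k, (s + ε • (fun _ => 1 : V)) k) / ε)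
  refine mem_A_of_pair_sums hε n _ (fun w hw i j hij => ?_) ((div_lt_iff₀ hε).1 hn)
  have h1 := h w hw i j hij
  have h2 := mul_le_mul_of_nonneg_left (one_le_pair_sum hw hij) hε.le
  simp only [map_add, map_smul, Pi.add_apply, Pi.smul_apply, smul_eq_mul]
  linarith

theorem mk_mem_closure_projA {s : V} (hs : s ≠ 0)
    (h : ∀ w ∈ W, ∀ i j, i ≠ j → 0 ≤ w s i + w s j) :
    Projectivization.mk ℝ s hs ∈ closure projA := by
  have hcont : Continuous (Projectivization.mk' ℝ : {v : V // v ≠ 0} → RP3) :=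
    continuous_coinduced_rng
  refine hcont.closure_preimage_subset projA (?_ : (⟨s, hs⟩ : {v : V // v ≠ 0}) ∈ _)
  rw [Metric.mem_closure_iff]
  intro ε hε
  -- If the shift vanished, `s 0 + s 1` would be `-ε`, against `h` at the identity.
  have hne : s + (ε / 2) • (fun _ => 1 : V) ≠ 0 := fun h0 => by
    have h1 := h 1 W.one_mem 0 1 (by decide)
    have e0 := congrFun h0 0
    have e1 := congrFun h0 1
    simp only [Pi.add_apply, Pi.smul_apply, smul_eq_mul, Pi.zero_apply,
      LinearEquiv.coe_one, id_eq] at e0 e1 h1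
    linarith
  refine ⟨⟨_, hne⟩, ⟨_, hne, add_smul_one_mem_A h (half_pos hε), rfl⟩, ?_⟩
  rw [Subtype.dist_eq, dist_self_add_right, norm_smul, pi_norm_const, norm_one, mul_one,
    Real.norm_of_nonneg (half_pos hε).le]
  exact half_lt_self hε

end Apollonian

theorem proposition5p3 (p : Apollonian.RP3) (hp : p ∉ closure Apollonian.projA)
    (s : Apollonian.V) (hs : s ≠ 0) (hsp : Projectivization.mk ℝ s hs = p) :
    ∃ w ∈ Apollonian.W, Apollonian.negCount (w s) = 3 ∨
      (Apollonian.negCount (w s) = 2 ∧ Apollonian.zeroCount (w s) = 1) := by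
  subst hsp
  obtain ⟨w, hw, i, j, hij, hlt⟩ : ∃ w ∈ Apollonian.W, ∃ i j, i ≠ j ∧ w s i + w s j < 0 := by
    by_contra! hcon
    exact hp (Apollonian.mk_mem_closure_projA hs hcon)
  obtain ⟨u, hu, h3⟩ := Apollonian.exists_negCount_eq_three hij hlt
  exact ⟨u * w, Apollonian.W.mul_mem hu hw, Or.inl h3⟩
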